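/- Let $p\ge 2$ be an integer, $\nu=p/2-1$, $\kappa\ge 0$. Let $I_\mu(z)=(z/2)^{\mu}\sum_{s\ge0}\frac{(z/2)^{2s}}{s!\,\Gamma(\mu+s+1)}$ be the modified Bessel function of the first kind. The von Mises–Fisher (VMF) mechanism on the unit sphere $\mathbb S^{p-1}\subset\mathbb R^p$ sends $x\in\mathbb S^{p-1}$ to the distribution $V_\kappa(x)$ on $\mathbb S^{p-1}$ whose density with respect to surface measure is $$y\mapsto \frac{1}{C_{p,\kappa}}e^{\kappa x^Ty},\qquad C_{p,\kappa}=\frac{(2\pi)^{\nu+1}I_\nu(\kappa)}{\kappa^\nu}\quad(\kappa>0),$$ and $C_{p,0}=\lim_{\kappa\to0^+}C_{p,\kappa}=\frac{(2\pi)^{\nu+1}}{2^\nu\Gamma(\nu+1)}$, so that $V_0(x)$ is the uniform distribution. For $\alpha>1$ and probability measures $P,Q$ let $D_\alpha(P\|Q)=\frac1{\alpha-1}\log\int\left(\frac{dP}{dQ}\right)^{\alpha}dQ$ be the Rényi divergence ($+\infty$ if $P\not\ll Q$). A mechanism $M$ satisfies $(\alpha,\tau)$-RDP if $D_\alpha(M(x)\|M(x'))\le\tau$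 for all adjacent inputs $x,x'$; here any two points of $\mathbb S^{p-1}$ count as adjacent. For $\kappa>0$ put $$\tau_\alpha=\frac{\nu}{\alpha-1}\log\left(\frac1{2\alpha-1}\right)+\frac1{\alpha-1}\log\left(\frac{I_\nu((2\alpha-1)\kappa)}{I_\nu(\kappa)}\right),$$ and for $\kappa=0$ let $\tau_\alpha$ be the limit of this expression as $\kappa\to0^+$, which exists and equals $0$. Then every $V_\kappa(x)$ is a probability measure, and: 1. For every $\alpha\in(1,\infty)$, the VMF mechanism $V_\kappa$ satisfies $(\alpha,\tau_\alpha)$-RDP. 2. For all $x,x'\in\mathbb S^{p-1}$, $D_\alpha(V_\kappa(x)\|V_\kappa(x'))$ tends to the Kullback–Leibler divergence $\mathrm{KL}(V_\kappa(x)\|V_\kappa(x'))$ as $\alpha\to1^+$. The limit $\tau_1=\lim_{\alpha\to1^+}\tau_\alpha$ exists and is finite, and for all $x,x'\in\mathbb S^{p-1}$ $$\mathrm{KL}(V_\kappa(x)\|V_\kappa(x'))\le\tau_1\le 2\kappa\,\frac{I_{\nu+1}(\kappa)}{I_\nu(\kappa)},$$ where the right-hand side is read as $0$ (its limit) when $\kappa=0$.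 -/

import Mathlib

open MeasureTheory Filter Topology
open scoped ENNReal NNReal

/-- The modified Bessel function of the first kind of order `ν` at `z`, through its power series
`I_ν(z) = (z/2)^ν ∑_{s ≥ 0} (z/2)^{2s} / (s! Γ(ν+s+1))` (used for `ν ≥ 0` and `z ≥ 0`). -/
noncomputable def besselI (ν z : ℝ) : ℝ :=
  (z / 2) ^ ν * ∑' s : ℕ, (z / 2) ^ (2 * s) / ((s.factorial : ℝ) * Real.Gamma (ν + s + 1))

/-- The Bessel order `ν = p/2 - 1` attached to the dimension `p`. -/
noncomputable def vmfOrder (p : ℕ) : ℝ := (p : ℝ) / 2 - 1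

/-- The unit sphere `S^{p-1}` of `ℝ^p` with the Euclidean norm. -/
abbrev UnitSphere (p : ℕ) : Type := Metric.sphere (0 : EuclideanSpace ℝ (Fin p)) 1

/-- The surface measure of the unit sphere `S^{p-1}`. -/
noncomputable def surfaceMeasure (p : ℕ) : Measure (UnitSphere p) :=
  (volume : Measure (EuclideanSpace ℝ (Fin p))).toSphere

/-- The normalisation factor `C_{p,κ} = (2π)^{ν+1} I_ν(κ) / κ^ν`, `ν = p/2 - 1`. At `κ = 0`, where
this expression may read `0/0`, it is its limit `(2π)^{ν+1} / (2^ν Γ(ν+1))`, the area of the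
sphere. -/
noncomputable def vmfNormalizer (p : ℕ) (κ : ℝ) : ℝ :=
  if κ = 0 then
    (2 * Real.pi) ^ (vmfOrder p + 1) / ((2 : ℝ) ^ vmfOrder p * Real.Gamma (vmfOrder p + 1))
  else (2 * Real.pi) ^ (vmfOrder p + 1) * besselI (vmfOrder p) κ / κ ^ vmfOrder p

/-- The von Mises-Fisher density `y ↦ exp(κ xᵀy) / C_{p,κ}` with centre `x` and concentration
`κ`. -/
noncomputable def vmfDensity (p : ℕ) (κ : ℝ) (x y : UnitSphere p) : ℝ :=
  1 / vmfNormalizer p κ *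
    Real.exp (κ * inner ℝ (x : EuclideanSpace ℝ (Fin p)) (y : EuclideanSpace ℝ (Fin p)))

/-- The VMF mechanism on `S^{p-1}`: the secret `x` is sent to the distribution with density
`vmfDensity p κ x` with respect to the surface measure. -/
noncomputable def vmfMechanism (p : ℕ) (κ : ℝ) (x : UnitSphere p) : Measure (UnitSphere p) :=
  (surfaceMeasure p).withDensity fun y => ENNReal.ofReal (vmfDensity p κ x y)

open Classical in
/-- The Rényi divergence of order `α > 1`,
`D_α(P‖Q) = (α-1)⁻¹ log E_Q[(dP/dQ)^α]`, with values in the extended reals; it is `⊤` if `P` is not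
absolutely continuous with respect to `Q`. -/
noncomputable def renyiDiv {Ω : Type*} [MeasurableSpace Ω] (α : ℝ) (P Q : Measure Ω) : EReal :=
  if P ≪ Q then ((1 / (α - 1) : ℝ) : EReal) * ENNReal.log (∫⁻ ω, P.rnDeriv Q ω ^ α ∂Q) else ⊤

/-- The mechanism `M` satisfies `(α, τ)`-Rényi differential privacy for the adjacency relation
`adj` on its inputs. -/
def IsRDP {X Ω : Type*} [MeasurableSpace Ω] (adj : X → X → Prop) (M : X → Measure Ω)
    (α τ : ℝ) : Prop :=
  ∀ x x' : X, adj x x' → renyiDiv α (M x) (M x') ≤ (τ : EReal)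

/-- The expression
`ν/(α-1) · log(1/(2α-1)) + 1/(α-1) · log(I_ν((2α-1)κ)/I_ν(κ))`, `ν = p/2 - 1`, for `κ > 0`. -/
noncomputable def vmfTauFormula (p : ℕ) (κ α : ℝ) : ℝ :=
  vmfOrder p / (α - 1) * Real.log (1 / (2 * α - 1)) +
    1 / (α - 1) * Real.log (besselI (vmfOrder p) ((2 * α - 1) * κ) / besselI (vmfOrder p) κ)

/-- The privacy parameter `τ_α`: the expression `vmfTauFormula` for `κ ≠ 0`, and `0`, its limit as
`κ → 0⁺`, for `κ = 0`, where the quotient of Bessel functions may read `0/0`. -/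
noncomputable def vmfTau (p : ℕ) (κ α : ℝ) : ℝ :=
  if κ = 0 then 0 else vmfTauFormula p κ α

/-!
The exponential integral `∫ exp (vᵀ y) dσ(y)` over the unit sphere depends only on `‖v‖`, and equals
`vmfNormalizer p ‖v‖`. To see this, the moments `∫ (xᵀ y)ⁿ dσ(y)` for a unit vector `x` are found by
integrating `(xᵀ u)ⁿ exp (-‖u‖²)` over the whole space in two ways: in an orthonormal basis
containing `x`, where the integrand is a product, and in polar coordinates. The odd moments vanish,
and by Legendre duplication the even ones are the coefficients of the Bessel series
(`integral_sphere_inner_pow_even`). Summing them gives the normalisation factor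
(`integral_sphere_exp_inner`) and its derivative, which carries `I_{ν+1}`
(`hasDerivAt_vmfNormalizer`). The positivity of the coefficients makes the normalisation factor
increasing on `[0, ∞)`.

The distribution with centre `x` has the density `exp (κ (x - x')ᵀ y)` with respect to the one with
centre `x'`, both having the same normalisation factor. Hence the Rényi divergence of order `α` is
`(α - 1)⁻¹ log (C_{‖κ (α x - (α - 1) x')‖} / C_κ)`, where `C_t` is the normalisation factor, and the
norm is at most `(2 α - 1) κ`. By monotonicity the divergence is at most
`(α - 1)⁻¹ log (C_{(2 α - 1) κ} / C_κ)`, which is `τ_α` (`renyiDiv_vmfMechanism_le_vmfTau`).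

Both quantities are slopes, between `1` and `α`, of functions vanishing at `1`. The Rényi divergence
is the slope of the cumulant generating function of the log-likelihood ratio, whose derivative at
`1` is the Kullback-Leibler divergence (`tendsto_renyiDiv_withDensity_exp`). The parameter `τ_α` is
the slope of `log (C_{(2 α - 1) κ} / C_κ)`, whose derivative at `1` is `2 κ I_{ν+1}(κ) / I_ν(κ)`
(`tendsto_vmfTau`), so that the last inequality of the theorem is an equality.
-/

open ProbabilityTheory

/-! ### Moments of a linear functional on the sphere -/

theorem integral_Ioi_pow_mul_exp_neg_sq (n : ℕ) :
    ∫ r in Set.Ioi (0 : ℝ), r ^ n * Real.exp (-r ^ 2) = Real.Gamma ((n + 1) / 2) / 2 := by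
  have h := integral_rpow_mul_exp_neg_rpow (p := 2) (q := n) two_pos
    (by linarith [n.cast_nonneg (α := ℝ)])
  simp only [Real.rpow_natCast, Real.rpow_ofNat] at h
  rw [h]
  ring

theorem integral_pow_even_mul_exp_neg_sq (s : ℕ) :
    ∫ u : ℝ, u ^ (2 * s) * Real.exp (-u ^ 2) = Real.Gamma (s + 1 / 2) := by
  have h := integral_comp_abs (f := fun u : ℝ => u ^ (2 * s) * Real.exp (-u ^ 2))
  simp only [pow_mul, sq_abs] at h
  simp only [pow_mul]
  rw [h]
  simp only [← pow_mul]
  rw [integral_Ioi_pow_mul_exp_neg_sq]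
  push_cast
  rw [mul_div_cancel₀ _ two_ne_zero]
  congr 1
  ring

theorem exists_orthonormalBasis_apply_eq {p : ℕ} (x : UnitSphere p) (i : Fin p) :
    ∃ b : OrthonormalBasis (Fin p) ℝ (EuclideanSpace ℝ (Fin p)), b i = x := by
  have hx : Orthonormal ℝ (({i} : Set (Fin p)).domRestrict
      fun _ => (x : EuclideanSpace ℝ (Fin p))) := by
    constructor
    · intro j
      exact norm_eq_of_mem_sphere x
    · intro j k hjk
      exact absurd (Subsingleton.elim j k) hjk
  obtain ⟨b, hb⟩ := hx.exists_orthonormalBasis_extension_of_card_eq (by simp)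
  exact ⟨b, hb i rfl⟩

/-- The even moments of a linear functional under the Gaussian weight `exp (-‖u‖²)`: in an
orthonormal basis containing `x` the integrand is a product over the coordinates. -/
theorem integral_inner_pow_even_mul_exp_neg_sq {p : ℕ} (hp : 1 ≤ p) (x : UnitSphere p) (s : ℕ) :
    ∫ u : EuclideanSpace ℝ (Fin p),
        inner ℝ (x : EuclideanSpace ℝ (Fin p)) u ^ (2 * s) * Real.exp (-‖u‖ ^ 2) =
      Real.Gamma (s + 1 / 2) * √Real.pi ^ (p - 1) := by
  obtain ⟨b, hb⟩ := exists_orthonormalBasis_apply_eq x ⟨0, hp⟩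
  set i : Fin p := ⟨0, hp⟩
  rw [← b.measurePreserving_repr_symm.integral_comp
    b.repr.symm.toHomeomorph.measurableEmbedding]
  rw [← (EuclideanSpace.volume_preserving_symm_measurableEquiv_toLp (Fin p)).symm.integral_comp']
  have hprod : ∀ w : Fin p → ℝ,
      inner ℝ (x : EuclideanSpace ℝ (Fin p)) (b.repr.symm (WithLp.toLp 2 w)) ^ (2 * s) *
        Real.exp (-‖b.repr.symm (WithLp.toLp 2 w)‖ ^ 2) =
      ∏ j, (if j = i then (w j) ^ (2 * s) else 1) * Real.exp (-(w j) ^ 2) := by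
    intro w
    rw [← hb, ← b.repr_apply_apply, LinearIsometryEquiv.apply_symm_apply,
      LinearIsometryEquiv.norm_map, EuclideanSpace.real_norm_sq_eq, Finset.prod_mul_distrib,
      ← Real.exp_sum]
    simp
  have : ∀ w : Fin p → ℝ, (MeasurableEquiv.toLp 2 (Fin p → ℝ)) w = WithLp.toLp 2 w := fun _ => rfl
  simp only [MeasurableEquiv.symm_symm, this, hprod]
  rw [integral_fintype_prod_volume_eq_prod
    (fun j (w : ℝ) => (if j = i then w ^ (2 * s) else 1) * Real.exp (-w ^ 2)),
    ← Finset.mul_prod_erase _ _ (Finset.mem_univ i)]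
  congr 1
  · simpa using integral_pow_even_mul_exp_neg_sq s
  · rw [Finset.prod_congr rfl (g := fun _ => √Real.pi)]
    · simp
    · intro j hj
      have := integral_gaussian 1
      simp only [Finset.ne_of_mem_erase hj, if_false, one_mul]
      simpa using this

/-- Polar coordinates for a homogeneous polynomial against the Gaussian weight. -/
theorem integral_inner_pow_mul_exp_neg_sq_eq_sphere {p : ℕ} (hp : 1 ≤ p) (x : UnitSphere p)
    (n : ℕ) :
    ∫ u : EuclideanSpace ℝ (Fin p),
        inner ℝ (x : EuclideanSpace ℝ (Fin p)) u ^ n * Real.exp (-‖u‖ ^ 2) =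
      (∫ y, inner ℝ (x : EuclideanSpace ℝ (Fin p)) (y : EuclideanSpace ℝ (Fin p)) ^ n
        ∂surfaceMeasure p) * (Real.Gamma ((n + p) / 2) / 2) := by
  have : Nonempty (Fin p) := ⟨⟨0, hp⟩⟩
  set E := EuclideanSpace ℝ (Fin p)
  let f : E → ℝ := fun u => inner ℝ (x : E) u ^ n * Real.exp (-‖u‖ ^ 2)
  calc
    ∫ u, f u = ∫ u : ({(0)}ᶜ : Set E), f u ∂((volume : Measure E).comap (↑)) := by
      rw [integral_subtype_comap (measurableSet_singleton _).compl f,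
        restrict_compl_singleton]
    _ = ∫ q, inner ℝ (x : E) (q.1 : E) ^ n * ((q.2 : ℝ) ^ n * Real.exp (-(q.2 : ℝ) ^ 2))
          ∂(volume : Measure E).toSphere.prod (.volumeIoiPow (Module.finrank ℝ E - 1)) := by
      rw [← (volume : Measure E).measurePreserving_homeomorphUnitSphereProd.integral_comp
        (Homeomorph.measurableEmbedding _)]
      refine integral_congr_ae (Eventually.of_forall fun u => ?_)
      have hu : ‖(u : E)‖ ≠ 0 := norm_ne_zero_iff.2 u.2
      simp only [f, homeomorphUnitSphereProd_apply_fst_coe, homeomorphUnitSphereProd_apply_snd_coe,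
        inner_smul_right]
      rw [← mul_assoc, ← mul_pow]
      congr 2
      field_simp
    _ = (∫ y, inner ℝ (x : E) (y : E) ^ n ∂(volume : Measure E).toSphere) *
          ∫ r : Set.Ioi (0 : ℝ), (r : ℝ) ^ n * Real.exp (-(r : ℝ) ^ 2)
            ∂.volumeIoiPow (Module.finrank ℝ E - 1) :=
      integral_prod_mul (fun y : UnitSphere p => inner ℝ (x : E) (y : E) ^ n)
        (fun r : Set.Ioi (0 : ℝ) => (r : ℝ) ^ n * Real.exp (-(r : ℝ) ^ 2))
    _ = _ := by
      rw [surfaceMeasure]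
      congr 1
      have hdim : Module.finrank ℝ E = p := finrank_euclideanSpace_fin
      rw [hdim]
      simp only [Measure.volumeIoiPow, ENNReal.ofReal]
      rw [integral_withDensity_eq_integral_smul (by fun_prop),
        integral_subtype_comap measurableSet_Ioi
          fun a : ℝ => Real.toNNReal (a ^ (p - 1)) • (a ^ n * Real.exp (-a ^ 2))]
      have h := integral_Ioi_pow_mul_exp_neg_sq (n + (p - 1))
      have hc : ((n + (p - 1) : ℕ) : ℝ) + 1 = n + p := by
        rw [← Nat.cast_add_one, add_assoc, Nat.sub_add_cancel hp, Nat.cast_add]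
      rw [hc] at h
      rw [← h]
      refine setIntegral_congr_fun measurableSet_Ioi fun a ha => ?_
      simp only [NNReal.smul_def, Real.coe_toNNReal _ (pow_nonneg (le_of_lt ha) _), smul_eq_mul]
      ring

theorem integral_sphere_inner_pow_odd {p : ℕ} (hp : 1 ≤ p) (x : UnitSphere p) (s : ℕ) :
    ∫ y, inner ℝ (x : EuclideanSpace ℝ (Fin p)) (y : EuclideanSpace ℝ (Fin p)) ^ (2 * s + 1)
      ∂surfaceMeasure p = 0 := by
  have h := integral_inner_pow_mul_exp_neg_sq_eq_sphere hp x (2 * s + 1)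
  have hodd := integral_neg_eq_self (fun u : EuclideanSpace ℝ (Fin p) =>
    inner ℝ (x : EuclideanSpace ℝ (Fin p)) u ^ (2 * s + 1) * Real.exp (-‖u‖ ^ 2)) volume
  simp only [inner_neg_right, norm_neg, Odd.neg_pow ⟨s, rfl⟩, neg_mul, integral_neg] at hodd
  have hΓ : 0 < Real.Gamma (((2 * s + 1 : ℕ) + p : ℝ) / 2) := by
    apply Real.Gamma_pos_of_pos
    positivity
  have h0 := h ▸ self_eq_neg.1 hodd.symm
  exact (mul_eq_zero.1 h0).resolve_right (by positivity)

theorem integral_sphere_inner_pow_even {p : ℕ} (hp : 1 ≤ p) (x : UnitSphere p) (s : ℕ) :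
    ∫ y, inner ℝ (x : EuclideanSpace ℝ (Fin p)) (y : EuclideanSpace ℝ (Fin p)) ^ (2 * s)
      ∂surfaceMeasure p =
      (2 * s).factorial * ((2 * Real.pi) ^ (vmfOrder p + 1) / 2 ^ vmfOrder p *
        ((1 / 2) ^ (2 * s) / (s.factorial * Real.Gamma (vmfOrder p + s + 1)))) := by
  have h := integral_inner_pow_mul_exp_neg_sq_eq_sphere hp x (2 * s)
  rw [integral_inner_pow_even_mul_exp_neg_sq hp] at h
  have hν : vmfOrder p + 1 = p / 2 := by rw [vmfOrder]; ring
  have hΓ : 0 < Real.Gamma (s + p / 2 : ℝ) := by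
    apply Real.Gamma_pos_of_pos
    have : (0 : ℝ) < p := by exact_mod_cast hp
    positivity
  have e1 : ((2 * s : ℕ) + p : ℝ) / 2 = s + p / 2 := by push_cast; ring
  have e2 : vmfOrder p + s + 1 = s + p / 2 := by linarith
  rw [e1] at h
  rw [e2]
  have hpi : √Real.pi ^ p = Real.pi ^ (p / 2 : ℝ) := by
    rw [Real.sqrt_eq_rpow, ← Real.rpow_natCast, ← Real.rpow_mul Real.pi_pos.le]
    congr 1
    ring
  have e3 : (2 * Real.pi) ^ (vmfOrder p + 1) / 2 ^ vmfOrder p = 2 * √Real.pi ^ p := by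
    rw [hpi, Real.mul_rpow two_pos.le Real.pi_pos.le, Real.rpow_add_one two_ne_zero, ← hν]
    have : (2 : ℝ) ^ vmfOrder p ≠ 0 := by positivity
    field_simp
  -- Legendre duplication gives the value of `Γ(s + 1/2)` in terms of factorials.
  have hdup : Real.Gamma (s + 1 / 2) * (s.factorial * 4 ^ s) = (2 * s).factorial * √Real.pi := by
    have h2 := Real.Gamma_mul_Gamma_add_half (s + 1 / 2 : ℝ)
    have h3 : (s : ℝ) + 1 / 2 + 1 / 2 = s + 1 := by ring
    have h4 : 2 * ((s : ℝ) + 1 / 2) = (2 * s : ℕ) + 1 := by push_cast; ring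
    rw [h3, h4, Real.Gamma_nat_eq_factorial, Real.Gamma_nat_eq_factorial] at h2
    have h5 : (2 : ℝ) ^ (1 - ((2 * s : ℕ) + 1) : ℝ) = (4 ^ s)⁻¹ := by
      rw [show (1 - ((2 * s : ℕ) + 1) : ℝ) = -((2 * s : ℕ) : ℝ) by ring,
        Real.rpow_neg two_pos.le, Real.rpow_natCast, pow_mul]
      norm_num
    rw [h5] at h2
    field_simp at h2 ⊢
    linarith
  have hf : (0 : ℝ) < s.factorial := by exact_mod_cast s.factorial_pos
  have hπp : √Real.pi ^ p = √Real.pi * √Real.pi ^ (p - 1) := by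
    rw [← pow_succ', Nat.sub_add_cancel hp]
  have h14 : ((1 : ℝ) / 2) ^ (2 * s) = (4 ^ s)⁻¹ := by
    rw [pow_mul, ← inv_pow]; norm_num
  rw [e3, hπp, h14]
  generalize Real.Gamma (s + 1 / 2) = G at h hdup
  generalize Real.Gamma (s + p / 2 : ℝ) = H at h hΓ ⊢
  field_simp at h ⊢
  linear_combination (-(s.factorial : ℝ) * 4 ^ s) * h + 2 * √Real.pi ^ (p - 1) * hdup

/-! ### The exponential integral over the sphere -/

instance isFiniteMeasure_surfaceMeasure (p : ℕ) : IsFiniteMeasure (surfaceMeasure p) := by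
  unfold surfaceMeasure
  infer_instance

theorem integrable_surfaceMeasure_of_continuous {p : ℕ} {f : UnitSphere p → ℝ}
    (hf : Continuous f) : Integrable f (surfaceMeasure p) :=
  hf.integrable_of_hasCompactSupport (HasCompactSupport.of_compactSpace f)

theorem abs_inner_unitSphere_le_one {p : ℕ} (x y : UnitSphere p) :
    |inner ℝ (x : EuclideanSpace ℝ (Fin p)) (y : EuclideanSpace ℝ (Fin p))| ≤ 1 := by
  simpa using abs_real_inner_le_norm (x : EuclideanSpace ℝ (Fin p)) y

/-- Termwise integration of the exponential series. With `k = 0` it expands the exponential integral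
over the sphere, with `k = 1` its derivative in `t`. -/
theorem hasSum_integral_sphere_inner_pow_mul_exp {p : ℕ} (x : UnitSphere p) (t : ℝ) (k : ℕ) :
    HasSum (fun n : ℕ => t ^ n / n.factorial *
        ∫ y, inner ℝ (x : EuclideanSpace ℝ (Fin p)) (y : EuclideanSpace ℝ (Fin p)) ^ (n + k)
          ∂surfaceMeasure p)
      (∫ y, inner ℝ (x : EuclideanSpace ℝ (Fin p)) (y : EuclideanSpace ℝ (Fin p)) ^ k *
        Real.exp (t * inner ℝ (x : EuclideanSpace ℝ (Fin p)) (y : EuclideanSpace ℝ (Fin p)))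
        ∂surfaceMeasure p) := by
  have hexp : ∀ u : ℝ, HasSum (fun n : ℕ => u ^ n / n.factorial) (Real.exp u) := by
    intro u
    rw [Real.exp_eq_exp_ℝ]
    exact NormedSpace.expSeries_div_hasSum_exp u
  simp only [← integral_const_mul]
  refine hasSum_integral_of_dominated_convergence (fun n _ => |t| ^ n / n.factorial)
    (fun n => ?_) (fun n => Eventually.of_forall fun y => ?_)
    (Eventually.of_forall fun y => (hexp |t|).summable) (integrable_const _)
    (Eventually.of_forall fun y => ?_)
  · exact (integrable_surfaceMeasure_of_continuous (by fun_prop)).aestronglyMeasurable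
  · rw [norm_mul, norm_div, norm_pow, norm_pow]
    simp only [Real.norm_eq_abs, Nat.abs_cast]
    exact mul_le_of_le_one_right (by positivity)
      (pow_le_one₀ (abs_nonneg _) (abs_inner_unitSphere_le_one x y))
  · refine ((hexp _).mul_left _).congr_fun ?_
    intro n
    ring

/-- The generating function of the even moments: the exponential integral over the sphere is the
power series of the Bessel function. -/
theorem hasSum_integral_sphere_exp_inner {p : ℕ} (hp : 1 ≤ p) (x : UnitSphere p) (t : ℝ) :
    HasSum (fun s : ℕ => (2 * Real.pi) ^ (vmfOrder p + 1) / 2 ^ vmfOrder p *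
        ((t / 2) ^ (2 * s) / (s.factorial * Real.Gamma (vmfOrder p + s + 1))))
      (∫ y, Real.exp (t * inner ℝ (x : EuclideanSpace ℝ (Fin p)) (y : EuclideanSpace ℝ (Fin p)))
        ∂surfaceMeasure p) := by
  have h := hasSum_integral_sphere_inner_pow_mul_exp x t 0
  simp only [pow_zero, one_mul, add_zero] at h
  have hinj : Function.Injective fun s : ℕ => 2 * s := fun a b hab => by simpa using hab
  rw [← hinj.hasSum_iff] at h
  · refine h.congr_fun fun s => ?_
    have hf : ((2 * s).factorial : ℝ) ≠ 0 := by exact_mod_cast (2 * s).factorial_ne_zero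
    simp only [Function.comp_apply]
    rw [integral_sphere_inner_pow_even hp, div_pow, div_pow, one_pow]
    field_simp
  · intro n hn
    obtain ⟨s, rfl | rfl⟩ := n.even_or_odd'
    · exact absurd ⟨s, rfl⟩ hn
    · rw [integral_sphere_inner_pow_odd hp, mul_zero]

theorem hasSum_integral_sphere_inner_mul_exp_inner {p : ℕ} (hp : 1 ≤ p) (x : UnitSphere p)
    (t : ℝ) :
    HasSum (fun s : ℕ => (2 * Real.pi) ^ (vmfOrder p + 1) / 2 ^ vmfOrder p * (t / 2) *
        ((t / 2) ^ (2 * s) / (s.factorial * Real.Gamma (vmfOrder p + 1 + s + 1))))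
      (∫ y, inner ℝ (x : EuclideanSpace ℝ (Fin p)) (y : EuclideanSpace ℝ (Fin p)) *
        Real.exp (t * inner ℝ (x : EuclideanSpace ℝ (Fin p)) (y : EuclideanSpace ℝ (Fin p)))
        ∂surfaceMeasure p) := by
  have h := hasSum_integral_sphere_inner_pow_mul_exp x t 1
  simp only [pow_one] at h
  have hinj : Function.Injective fun s : ℕ => 2 * s + 1 := fun a b hab => by simpa using hab
  rw [← hinj.hasSum_iff] at h
  · refine h.congr_fun fun s => ?_
    simp only [Function.comp_apply]
    rw [show 2 * s + 1 + 1 = 2 * (s + 1) by ring, integral_sphere_inner_pow_even hp,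
      show 2 * (s + 1) = 2 * s + 1 + 1 by ring, Nat.factorial_succ (2 * s + 1),
      Nat.factorial_succ s, div_pow, div_pow, one_pow]
    have hf : ((2 * s + 1).factorial : ℝ) ≠ 0 := by exact_mod_cast (2 * s + 1).factorial_ne_zero
    have hg : vmfOrder p + (s + 1 : ℕ) + 1 = vmfOrder p + 1 + s + 1 := by push_cast; ring
    rw [hg]
    push_cast
    have hs : (s : ℝ) + 1 ≠ 0 := by positivity
    field_simp
    ring
  · intro n hn
    obtain ⟨s, rfl | rfl⟩ := n.even_or_odd'
    · rw [integral_sphere_inner_pow_odd hp, mul_zero]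
    · exact absurd ⟨s, rfl⟩ hn

/-- The normalisation factor is the integral of the unnormalised density. -/
theorem integral_sphere_exp_inner {p : ℕ} (hp : 1 ≤ p) (x : UnitSphere p) {t : ℝ} (ht : 0 ≤ t) :
    ∫ y, Real.exp (t * inner ℝ (x : EuclideanSpace ℝ (Fin p)) (y : EuclideanSpace ℝ (Fin p)))
      ∂surfaceMeasure p = vmfNormalizer p t := by
  rw [← (hasSum_integral_sphere_exp_inner hp x t).tsum_eq, tsum_mul_left, vmfNormalizer]
  split_ifs with h0
  · rw [tsum_eq_single 0]
    · subst h0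
      simp [div_eq_mul_inv]
      ring
    · intro s hs
      simp [h0, hs]
  · have ht' : 0 < t := lt_of_le_of_ne ht (Ne.symm h0)
    rw [besselI, Real.div_rpow ht two_pos.le]
    have h1 : t ^ vmfOrder p ≠ 0 := by positivity
    field_simp

theorem integral_sphere_inner_mul_exp_inner {p : ℕ} (hp : 1 ≤ p) (x : UnitSphere p) {t : ℝ}
    (ht : 0 < t) :
    ∫ y, inner ℝ (x : EuclideanSpace ℝ (Fin p)) (y : EuclideanSpace ℝ (Fin p)) *
        Real.exp (t * inner ℝ (x : EuclideanSpace ℝ (Fin p)) (y : EuclideanSpace ℝ (Fin p)))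
      ∂surfaceMeasure p =
      (2 * Real.pi) ^ (vmfOrder p + 1) * besselI (vmfOrder p + 1) t / t ^ vmfOrder p := by
  rw [← (hasSum_integral_sphere_inner_mul_exp_inner hp x t).tsum_eq, tsum_mul_left, besselI,
    Real.rpow_add_one (by positivity : t / 2 ≠ 0), Real.div_rpow ht.le two_pos.le]
  have h1 : t ^ vmfOrder p ≠ 0 := by positivity
  field_simp

theorem vmfOrder_nonneg {p : ℕ} (hp : 2 ≤ p) : 0 ≤ vmfOrder p := by
  have : (2 : ℝ) ≤ p := by exact_mod_cast hp
  rw [vmfOrder]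
  linarith

theorem nonempty_unitSphere {p : ℕ} (hp : 1 ≤ p) : Nonempty (UnitSphere p) :=
  ⟨⟨EuclideanSpace.single ⟨0, hp⟩ 1, by simp⟩⟩

theorem vmfNormalizer_mono {p : ℕ} (hp : 2 ≤ p) {s t : ℝ} (hs : 0 ≤ s) (hst : s ≤ t) :
    vmfNormalizer p s ≤ vmfNormalizer p t := by
  have hp1 : 1 ≤ p := by lia
  obtain ⟨x⟩ := nonempty_unitSphere hp1
  rw [← integral_sphere_exp_inner hp1 x hs, ← integral_sphere_exp_inner hp1 x (hs.trans hst)]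
  refine hasSum_le (fun n => ?_) (hasSum_integral_sphere_exp_inner hp1 x s)
    (hasSum_integral_sphere_exp_inner hp1 x t)
  have hν := vmfOrder_nonneg hp
  have hΓ : 0 < Real.Gamma (vmfOrder p + n + 1) := Real.Gamma_pos_of_pos (by positivity)
  gcongr

theorem vmfNormalizer_pos {p : ℕ} (hp : 2 ≤ p) {t : ℝ} (ht : 0 ≤ t) : 0 < vmfNormalizer p t := by
  refine lt_of_lt_of_le ?_ (vmfNormalizer_mono hp le_rfl ht)
  have hν := vmfOrder_nonneg hp
  have hΓ : 0 < Real.Gamma (vmfOrder p + 1) := Real.Gamma_pos_of_pos (by positivity)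
  rw [vmfNormalizer, if_pos rfl]
  positivity

/-- Rotation invariance: the exponential integral depends on the direction `v` only through its
norm. -/
theorem integral_sphere_exp_inner_eq_norm {p : ℕ} (hp : 1 ≤ p) (v : EuclideanSpace ℝ (Fin p)) :
    ∫ y, Real.exp (inner ℝ v (y : EuclideanSpace ℝ (Fin p))) ∂surfaceMeasure p =
      vmfNormalizer p ‖v‖ := by
  by_cases hv : v = 0
  · obtain ⟨x⟩ := nonempty_unitSphere hp
    rw [hv, norm_zero, ← integral_sphere_exp_inner hp x le_rfl]
    simp
  · have hn : ‖v‖ ≠ 0 := norm_ne_zero_iff.2 hv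
    rw [← integral_sphere_exp_inner hp ⟨‖v‖⁻¹ • v, by simp [norm_smul, hn]⟩ (norm_nonneg v)]
    simp only [real_inner_smul_left]
    field_simp

/-! ### Rényi divergence of an exponential tilt -/

section Tilt

variable {Ω : Type*} [MeasurableSpace Ω] {Q : Measure Ω} {Z : Ω → ℝ}

theorem mgf_one_eq_one_of_isProbabilityMeasure_withDensity_exp
    (hint : ∀ t, Integrable (fun ω => Real.exp (t * Z ω)) Q)
    (hP : IsProbabilityMeasure (Q.withDensity fun ω => ENNReal.ofReal (Real.exp (Z ω)))) :
    mgf Z Q 1 = 1 := by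
  have h := hP.measure_univ
  rw [withDensity_apply _ MeasurableSet.univ, Measure.restrict_univ,
    ← ofReal_integral_eq_lintegral_ofReal (by simpa using hint 1)
      (Eventually.of_forall fun ω => (Real.exp_pos _).le), ENNReal.ofReal_eq_one] at h
  simpa [mgf] using h

variable [IsProbabilityMeasure Q]

/-- For a density of the form `exp Z`, the Rényi divergence is a rescaled cumulant generating
function of `Z`. -/
theorem renyiDiv_withDensity_exp (hZ : Measurable Z)
    (hint : ∀ t, Integrable (fun ω => Real.exp (t * Z ω)) Q) (α : ℝ) :
    renyiDiv α (Q.withDensity fun ω => ENNReal.ofReal (Real.exp (Z ω))) Q =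
      ((1 / (α - 1) * cgf Z Q α : ℝ) : EReal) := by
  have hd := Measure.rnDeriv_withDensity Q
    (f := fun ω => ENNReal.ofReal (Real.exp (Z ω))) (by fun_prop)
  have hlint : ∫⁻ ω, (Q.withDensity fun ω => ENNReal.ofReal (Real.exp (Z ω))).rnDeriv Q ω ^ α ∂Q =
      ENNReal.ofReal (mgf Z Q α) := by
    rw [mgf, ofReal_integral_eq_lintegral_ofReal (hint α)
      (Eventually.of_forall fun ω => (Real.exp_pos _).le)]
    refine lintegral_congr_ae ?_
    filter_upwards [hd] with ω hω
    rw [hω, ENNReal.ofReal_rpow_of_pos (Real.exp_pos _), ← Real.exp_mul, mul_comm]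
  rw [renyiDiv, if_pos (withDensity_absolutelyContinuous _ _), hlint,
    ENNReal.log_ofReal_of_pos (mgf_pos (hint α)), EReal.coe_mul, cgf]

/-- For a density of the form `exp Z`, the Kullback-Leibler divergence is the derivative at `1` of
the moment generating function of `Z`. -/
theorem klDiv_withDensity_exp (hZ : Measurable Z)
    (hint : ∀ t, Integrable (fun ω => Real.exp (t * Z ω)) Q)
    (hP : IsProbabilityMeasure (Q.withDensity fun ω => ENNReal.ofReal (Real.exp (Z ω)))) :
    ((InformationTheory.klDiv (Q.withDensity fun ω => ENNReal.ofReal (Real.exp (Z ω))) Q :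
      ℝ≥0∞) : EReal) = ((∫ ω, Z ω * Real.exp (1 * Z ω) ∂Q : ℝ) : EReal) := by
  set P := Q.withDensity fun ω => ENNReal.ofReal (Real.exp (Z ω)) with hPdef
  have hac : P ≪ Q := withDensity_absolutelyContinuous _ _
  have hllr : llr P Q =ᵐ[P] Z := by
    have hd := hac.ae_le (Measure.rnDeriv_withDensity Q
      (f := fun ω => ENNReal.ofReal (Real.exp (Z ω))) (by fun_prop))
    filter_upwards [hd] with ω hω
    rw [llr, hω, ENNReal.toReal_ofReal (Real.exp_pos _).le, Real.log_exp]
  have hset : integrableExpSet Z Q = Set.univ := Set.eq_univ_of_forall hint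
  have hZint : Integrable Z P := by
    rw [hPdef, integrable_withDensity_iff (by fun_prop) (by simp)]
    have h := integrable_pow_mul_exp_of_mem_interior_integrableExpSet (X := Z) (μ := Q) (v := 1)
      (by simp [hset]) 1
    simpa [ENNReal.toReal_ofReal (Real.exp_pos _).le] using h
  have hfin : InformationTheory.klDiv P Q ≠ ∞ :=
    InformationTheory.klDiv_ne_top hac ((integrable_congr hllr).2 hZint)
  rw [← EReal.coe_ennreal_toReal hfin,
    InformationTheory.toReal_klDiv_of_measure_eq hac (by simp), integral_congr_ae hllr, hPdef,
    integral_withDensity_eq_integral_toReal_smul (by fun_prop) (by simp)]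
  simp [ENNReal.toReal_ofReal (Real.exp_pos _).le, mul_comm]

/-- The Rényi divergence is the slope of the cumulant generating function between `1` and `α`, so
it tends to the derivative at `1`, the Kullback-Leibler divergence. -/
theorem tendsto_renyiDiv_withDensity_exp (hZ : Measurable Z)
    (hint : ∀ t, Integrable (fun ω => Real.exp (t * Z ω)) Q)
    (hP : IsProbabilityMeasure (Q.withDensity fun ω => ENNReal.ofReal (Real.exp (Z ω)))) :
    Tendsto (fun α : ℝ =>
        renyiDiv α (Q.withDensity fun ω => ENNReal.ofReal (Real.exp (Z ω))) Q) (𝓝[>] 1)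
      (𝓝 ((InformationTheory.klDiv
        (Q.withDensity fun ω => ENNReal.ofReal (Real.exp (Z ω))) Q : ℝ≥0∞) : EReal)) := by
  rw [klDiv_withDensity_exp hZ hint hP]
  simp only [renyiDiv_withDensity_exp hZ hint]
  refine (continuous_coe_real_ereal.tendsto _).comp ?_
  have hset : integrableExpSet Z Q = Set.univ := Set.eq_univ_of_forall hint
  have h1 := mgf_one_eq_one_of_isProbabilityMeasure_withDensity_exp hint hP
  have hd : HasDerivAt (cgf Z Q) (∫ ω, Z ω * Real.exp (1 * Z ω) ∂Q) 1 := by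
    have h := (hasDerivAt_mgf (X := Z) (μ := Q) (t := 1) (by simp [hset])).log (by simp [h1])
    rwa [h1, div_one] at h
  refine (hasDerivAt_iff_tendsto_slope_left_right.1 hd).2.congr fun α => ?_
  rw [slope_def_field, cgf, cgf, h1, Real.log_one, sub_zero]
  ring

end Tilt

/-! ### The von Mises-Fisher distributions -/

theorem measurable_vmfDensity (p : ℕ) (κ : ℝ) (x : UnitSphere p) :
    Measurable (vmfDensity p κ x) := by
  unfold vmfDensity
  fun_prop

theorem isProbabilityMeasure_vmfMechanism {p : ℕ} (hp : 2 ≤ p) {κ : ℝ} (hκ : 0 ≤ κ)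
    (x : UnitSphere p) : IsProbabilityMeasure (vmfMechanism p κ x) := by
  have hC := vmfNormalizer_pos hp hκ
  constructor
  rw [vmfMechanism, withDensity_apply _ MeasurableSet.univ, Measure.restrict_univ,
    ← ofReal_integral_eq_lintegral_ofReal, ENNReal.ofReal_eq_one]
  · simp only [vmfDensity]
    rw [integral_const_mul, integral_sphere_exp_inner (by lia) x hκ, one_div_mul_cancel hC.ne']
  · exact integrable_surfaceMeasure_of_continuous (by unfold vmfDensity; fun_prop)
  · refine Eventually.of_forall fun y => ?_
    simp only [vmfDensity]
    positivity

theorem integral_vmfMechanism {p : ℕ} (hp : 2 ≤ p) {κ : ℝ} (hκ : 0 ≤ κ) (x : UnitSphere p)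
    (f : UnitSphere p → ℝ) :
    ∫ y, f y ∂vmfMechanism p κ x = ∫ y, vmfDensity p κ x y * f y ∂surfaceMeasure p := by
  have hC := vmfNormalizer_pos hp hκ
  have hm := measurable_vmfDensity p κ x
  rw [vmfMechanism, integral_withDensity_eq_integral_toReal_smul (by fun_prop) (by simp)]
  refine integral_congr_ae (Eventually.of_forall fun y => ?_)
  simp only [smul_eq_mul]
  rw [ENNReal.toReal_ofReal (by rw [vmfDensity]; positivity)]

/-- The log-likelihood ratio `κ (x - x')ᵀ y` of two von Mises-Fisher distributions with the same
concentration. -/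
noncomputable def vmfLogRatio (p : ℕ) (κ : ℝ) (x x' y : UnitSphere p) : ℝ :=
  κ * inner ℝ ((x : EuclideanSpace ℝ (Fin p)) - x') (y : EuclideanSpace ℝ (Fin p))

theorem continuous_vmfLogRatio (p : ℕ) (κ : ℝ) (x x' : UnitSphere p) :
    Continuous (vmfLogRatio p κ x x') := by
  unfold vmfLogRatio
  fun_prop

theorem vmfMechanism_eq_withDensity_exp (p : ℕ) (κ : ℝ) (x x' : UnitSphere p) :
    vmfMechanism p κ x = (vmfMechanism p κ x').withDensity
      fun y => ENNReal.ofReal (Real.exp (vmfLogRatio p κ x x' y)) := by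
  have hm := measurable_vmfDensity p κ x'
  have hc := (continuous_vmfLogRatio p κ x x').measurable
  rw [vmfMechanism, vmfMechanism, ← withDensity_mul _ (by fun_prop) (by fun_prop)]
  congr 1
  funext y
  rw [Pi.mul_apply, ← ENNReal.ofReal_mul' (Real.exp_pos _).le]
  simp only [vmfDensity, vmfLogRatio]
  rw [mul_assoc, ← Real.exp_add, inner_sub_left]
  ring_nf

theorem integrable_exp_mul_vmfLogRatio {p : ℕ} (hp : 2 ≤ p) {κ : ℝ} (hκ : 0 ≤ κ)
    (x x' : UnitSphere p) (t : ℝ) :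
    Integrable (fun y => Real.exp (t * vmfLogRatio p κ x x' y)) (vmfMechanism p κ x') := by
  have := isProbabilityMeasure_vmfMechanism hp hκ x'
  have hc := continuous_vmfLogRatio p κ x x'
  exact Continuous.integrable_of_hasCompactSupport (by fun_prop)
    (HasCompactSupport.of_compactSpace _)

theorem mgf_vmfLogRatio {p : ℕ} (hp : 2 ≤ p) {κ : ℝ} (hκ : 0 ≤ κ) (x x' : UnitSphere p) (α : ℝ) :
    mgf (vmfLogRatio p κ x x') (vmfMechanism p κ x') α =
      vmfNormalizer p ‖κ • (α • (x : EuclideanSpace ℝ (Fin p)) - (α - 1) • (x' :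
        EuclideanSpace ℝ (Fin p)))‖ / vmfNormalizer p κ := by
  rw [mgf, integral_vmfMechanism hp hκ, ← integral_sphere_exp_inner_eq_norm (by lia),
    ← integral_div]
  refine integral_congr_ae (Eventually.of_forall fun y => ?_)
  simp only [vmfDensity, vmfLogRatio]
  rw [mul_assoc, ← Real.exp_add, one_div, inv_mul_eq_div]
  congr 2
  simp only [real_inner_smul_left, inner_sub_left]
  ring

/-- The norm of `α x - (α - 1) x'` is largest, `2 α - 1`, at antipodal points. -/
theorem norm_smul_tilt_le {p : ℕ} {κ α : ℝ} (hκ : 0 ≤ κ) (hα : 1 < α) (x x' : UnitSphere p) :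
    ‖κ • (α • (x : EuclideanSpace ℝ (Fin p)) - (α - 1) • (x' : EuclideanSpace ℝ (Fin p)))‖ ≤
      (2 * α - 1) * κ := by
  rw [norm_smul, Real.norm_of_nonneg hκ, mul_comm]
  refine mul_le_mul_of_nonneg_right ((norm_sub_le _ _).trans ?_) hκ
  rw [norm_smul, norm_smul, norm_eq_of_mem_sphere, norm_eq_of_mem_sphere,
    Real.norm_of_nonneg (by linarith), Real.norm_of_nonneg (by linarith)]
  linarith

/-! ### The privacy parameter and its limits -/

theorem besselI_eq_vmfNormalizer {p : ℕ} {t : ℝ} (ht : 0 < t) :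
    besselI (vmfOrder p) t =
      vmfNormalizer p t * t ^ vmfOrder p / (2 * Real.pi) ^ (vmfOrder p + 1) := by
  have h1 : t ^ vmfOrder p ≠ 0 := by positivity
  have h2 : (2 * Real.pi) ^ (vmfOrder p + 1) ≠ 0 := by positivity
  rw [vmfNormalizer, if_neg ht.ne']
  field_simp

/-- In terms of the normalisation factor the powers of `2 α - 1` cancel. -/
theorem vmfTauFormula_eq_log_vmfNormalizer {p : ℕ} (hp : 2 ≤ p) {κ α : ℝ} (hκ : 0 < κ)
    (hα : 1 < α) :
    vmfTauFormula p κ α =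
      1 / (α - 1) * Real.log (vmfNormalizer p ((2 * α - 1) * κ) / vmfNormalizer p κ) := by
  have ha : 0 < 2 * α - 1 := by linarith
  have hC := vmfNormalizer_pos hp hκ.le
  have hC' := vmfNormalizer_pos hp (mul_pos ha hκ).le
  have hratio : besselI (vmfOrder p) ((2 * α - 1) * κ) / besselI (vmfOrder p) κ =
      (2 * α - 1) ^ vmfOrder p * (vmfNormalizer p ((2 * α - 1) * κ) / vmfNormalizer p κ) := by
    rw [besselI_eq_vmfNormalizer hκ, besselI_eq_vmfNormalizer (mul_pos ha hκ),
      Real.mul_rpow ha.le hκ.le]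
    have h1 : κ ^ vmfOrder p ≠ 0 := by positivity
    field_simp
  rw [vmfTauFormula, hratio, Real.log_mul (by positivity) (by positivity), Real.log_rpow ha,
    one_div (2 * α - 1), Real.log_inv]
  ring

theorem vmfTau_eq_log_vmfNormalizer {p : ℕ} (hp : 2 ≤ p) {κ α : ℝ} (hκ : 0 ≤ κ) (hα : 1 < α) :
    vmfTau p κ α =
      1 / (α - 1) * Real.log (vmfNormalizer p ((2 * α - 1) * κ) / vmfNormalizer p κ) := by
  rw [vmfTau]
  split_ifs with h
  · rw [h, mul_zero, div_self (vmfNormalizer_pos hp le_rfl).ne', Real.log_one, mul_zero]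
  · exact vmfTauFormula_eq_log_vmfNormalizer hp (lt_of_le_of_ne hκ (Ne.symm h)) hα

/-- The exponential integral over the sphere as a moment generating function, which extends the
normalisation factor smoothly to negative arguments. -/
theorem mgf_inner_eq_vmfNormalizer {p : ℕ} (hp : 1 ≤ p) (x : UnitSphere p) {t : ℝ} (ht : 0 ≤ t) :
    mgf (fun y : UnitSphere p =>
        inner ℝ (x : EuclideanSpace ℝ (Fin p)) (y : EuclideanSpace ℝ (Fin p))) (surfaceMeasure p) t = vmfNormalizer p t :=
  integral_sphere_exp_inner hp x ht

theorem integrable_exp_mul_inner {p : ℕ} (x : UnitSphere p) (t : ℝ) :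
    Integrable (fun y : UnitSphere p =>
      Real.exp (t * inner ℝ (x : EuclideanSpace ℝ (Fin p)) (y : EuclideanSpace ℝ (Fin p))))
      (surfaceMeasure p) :=
  integrable_surfaceMeasure_of_continuous (by fun_prop)

theorem continuousOn_vmfNormalizer {p : ℕ} (hp : 1 ≤ p) :
    ContinuousOn (vmfNormalizer p) (Set.Ici 0) := by
  obtain ⟨x⟩ := nonempty_unitSphere hp
  exact (continuous_mgf (integrable_exp_mul_inner x)).continuousOn.congr
    fun t ht => (mgf_inner_eq_vmfNormalizer hp x ht).symm

/-- The identity `(z ^ (-ν) I_ν(z))' = z ^ (-ν) I_{ν+1}(z)` for the normalisation factor. -/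
theorem hasDerivAt_vmfNormalizer {p : ℕ} (hp : 1 ≤ p) {t : ℝ} (ht : 0 < t) :
    HasDerivAt (vmfNormalizer p)
      ((2 * Real.pi) ^ (vmfOrder p + 1) * besselI (vmfOrder p + 1) t / t ^ vmfOrder p) t := by
  obtain ⟨x⟩ := nonempty_unitSphere hp
  have hset : integrableExpSet (fun y : UnitSphere p =>
      inner ℝ (x : EuclideanSpace ℝ (Fin p)) (y : EuclideanSpace ℝ (Fin p))) (surfaceMeasure p) =
      Set.univ := Set.eq_univ_of_forall (integrable_exp_mul_inner x)
  have h := hasDerivAt_mgf (t := t) (μ := surfaceMeasure p) (X := fun y : UnitSphere p =>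
    inner ℝ (x : EuclideanSpace ℝ (Fin p)) (y : EuclideanSpace ℝ (Fin p))) (by simp [hset])
  rw [integral_sphere_inner_mul_exp_inner hp x ht] at h
  refine h.congr_of_eventuallyEq ?_
  filter_upwards [lt_mem_nhds ht] with s hs
  exact (mgf_inner_eq_vmfNormalizer hp x hs.le).symm

theorem tendsto_vmfTauFormula_zero {p : ℕ} (hp : 2 ≤ p) {α : ℝ} (hα : 1 < α) :
    Tendsto (fun k : ℝ => vmfTauFormula p k α) (𝓝[>] 0) (𝓝 0) := by
  have hC := vmfNormalizer_pos hp le_rfl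
  have hcont := (continuousOn_vmfNormalizer (p := p) (by lia)) 0 Set.self_mem_Ici
  have h1 : Tendsto (vmfNormalizer p) (𝓝[>] 0) (𝓝 (vmfNormalizer p 0)) :=
    hcont.mono_left (nhdsWithin_mono _ Set.Ioi_subset_Ici_self)
  have h2 : Tendsto (fun k : ℝ => vmfNormalizer p ((2 * α - 1) * k)) (𝓝[>] 0)
      (𝓝 (vmfNormalizer p 0)) := by
    refine h1.comp (tendsto_nhdsWithin_iff.2 ⟨?_, ?_⟩)
    · refine Tendsto.mono_left ?_ nhdsWithin_le_nhds
      exact Continuous.tendsto' (by fun_prop) _ _ (mul_zero _)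
    · filter_upwards [self_mem_nhdsWithin] with k hk
      exact mul_pos (by linarith : 0 < 2 * α - 1) hk
  have h3 := ((h2.div h1 hC.ne').log (by simp [hC.ne'])).const_mul (1 / (α - 1))
  rw [div_self hC.ne', Real.log_one, mul_zero] at h3
  refine h3.congr' ?_
  filter_upwards [self_mem_nhdsWithin] with k hk
  exact (vmfTauFormula_eq_log_vmfNormalizer hp hk hα).symm

/-- `τ_α` is the slope of `log C_{p, (2α-1)κ}` between `1` and `α`; its limit is the logarithmic
derivative of the normalisation factor. -/
theorem tendsto_vmfTau {p : ℕ} (hp : 2 ≤ p) {κ : ℝ} (hκ : 0 ≤ κ) :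
    Tendsto (fun α : ℝ => vmfTau p κ α) (𝓝[>] 1)
      (𝓝 (2 * κ * (besselI (vmfOrder p + 1) κ / besselI (vmfOrder p) κ))) := by
  obtain rfl | hκ := hκ.eq_or_lt
  · simp [vmfTau]
  have hC := vmfNormalizer_pos hp hκ.le
  have hlin : HasDerivAt (fun α : ℝ => (2 * α - 1) * κ) (2 * κ) 1 := by
    simpa using (((hasDerivAt_id (1 : ℝ)).const_mul 2).sub_const 1).mul_const κ
  have hone : (2 * (1 : ℝ) - 1) * κ = κ := by ring
  have hd := hasDerivAt_vmfNormalizer (p := p) (by lia) hκ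
  rw [← hone] at hd
  have hlog := (hd.comp 1 hlin).log (by simpa only [Function.comp_apply, hone] using hC.ne')
  have hval : (2 * Real.pi) ^ (vmfOrder p + 1) * besselI (vmfOrder p + 1) κ / κ ^ vmfOrder p *
      (2 * κ) / vmfNormalizer p κ =
      2 * κ * (besselI (vmfOrder p + 1) κ / besselI (vmfOrder p) κ) := by
    rw [besselI_eq_vmfNormalizer hκ]
    have h1 : κ ^ vmfOrder p ≠ 0 := by positivity
    have h2 : (2 * Real.pi) ^ (vmfOrder p + 1) ≠ 0 := by positivity
    field_simp
  simp only [Function.comp_apply, hone] at hlog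
  rw [hval] at hlog
  refine (hasDerivAt_iff_tendsto_slope_left_right.1 hlog).2.congr' ?_
  filter_upwards [self_mem_nhdsWithin] with α hα
  have hα : 1 < α := hα
  have hC' := vmfNormalizer_pos hp (mul_pos (by linarith : 0 < 2 * α - 1) hκ).le
  rw [slope_def_field, vmfTau_eq_log_vmfNormalizer hp hκ.le hα, Real.log_div hC'.ne' hC.ne']
  simp only [hone]
  ring

/-! ### Divergences between von Mises-Fisher distributions -/

/-- The Rényi divergence depends on `x` and `x'` only through the norm of `α x - (α - 1) x'`, and
`τ_α` is its value at the largest such norm. -/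
theorem renyiDiv_vmfMechanism_le_vmfTau {p : ℕ} (hp : 2 ≤ p) {κ α : ℝ} (hκ : 0 ≤ κ) (hα : 1 < α)
    (x x' : UnitSphere p) :
    renyiDiv α (vmfMechanism p κ x) (vmfMechanism p κ x') ≤ (vmfTau p κ α : EReal) := by
  have := isProbabilityMeasure_vmfMechanism hp hκ x'
  rw [vmfMechanism_eq_withDensity_exp p κ x x', renyiDiv_withDensity_exp
    (continuous_vmfLogRatio p κ x x').measurable (integrable_exp_mul_vmfLogRatio hp hκ x x'),
    EReal.coe_le_coe_iff, vmfTau_eq_log_vmfNormalizer hp hκ hα, cgf, mgf_vmfLogRatio hp hκ]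
  have hC := vmfNormalizer_pos hp hκ
  have hC' := vmfNormalizer_pos hp (norm_nonneg
    (κ • (α • (x : EuclideanSpace ℝ (Fin p)) - (α - 1) • (x' : EuclideanSpace ℝ (Fin p)))))
  refine mul_le_mul_of_nonneg_left (Real.log_le_log (by positivity) ?_)
    (one_div_nonneg.2 (by linarith))
  exact div_le_div_of_nonneg_right
    (vmfNormalizer_mono hp (norm_nonneg _) (norm_smul_tilt_le hκ hα x x')) hC.le

theorem tendsto_renyiDiv_vmfMechanism {p : ℕ} (hp : 2 ≤ p) {κ : ℝ} (hκ : 0 ≤ κ)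
    (x x' : UnitSphere p) :
    Tendsto (fun α : ℝ => renyiDiv α (vmfMechanism p κ x) (vmfMechanism p κ x')) (𝓝[>] 1)
      (𝓝 ((InformationTheory.klDiv (vmfMechanism p κ x) (vmfMechanism p κ x') : ℝ≥0∞) :
        EReal)) := by
  have := isProbabilityMeasure_vmfMechanism hp hκ x'
  have hP := isProbabilityMeasure_vmfMechanism hp hκ x
  rw [vmfMechanism_eq_withDensity_exp p κ x x'] at hP ⊢
  exact tendsto_renyiDiv_withDensity_exp (continuous_vmfLogRatio p κ x x').measurable
    (integrable_exp_mul_vmfLogRatio hp hκ x x') hP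

theorem mainTheorem1 (p : ℕ) (hp : 2 ≤ p) (κ : ℝ) (hκ : 0 ≤ κ) :
    -- the mechanism outputs probability distributions
    (∀ x : UnitSphere p, IsProbabilityMeasure (vmfMechanism p κ x)) ∧
    -- the value of `τ_α` at `κ = 0` is the limit of the formula
    (∀ α : ℝ, 1 < α →
      Tendsto (fun k : ℝ => vmfTauFormula p k α) (𝓝[>] 0) (𝓝 (vmfTau p 0 α))) ∧
    -- `(α, τ_α)`-RDP, any two points of the sphere being adjacent
    (∀ α : ℝ, 1 < α → IsRDP (fun _ _ => True) (vmfMechanism p κ) α (vmfTau p κ α)) ∧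
    -- as `α → 1⁺` the Rényi divergence tends to the Kullback-Leibler divergence
    (∀ x x' : UnitSphere p,
      Tendsto (fun α : ℝ => renyiDiv α (vmfMechanism p κ x) (vmfMechanism p κ x')) (𝓝[>] 1)
        (𝓝 ((InformationTheory.klDiv (vmfMechanism p κ x) (vmfMechanism p κ x') : ℝ≥0∞) :
          EReal))) ∧
    -- `τ_1 = lim τ_α` bounds the Kullback-Leibler divergence and satisfies the stated inequality
    (∃ τ₁ : ℝ, Tendsto (fun α : ℝ => vmfTau p κ α) (𝓝[>] 1) (𝓝 τ₁) ∧
      (∀ x x' : UnitSphere p,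
        ((InformationTheory.klDiv (vmfMechanism p κ x) (vmfMechanism p κ x') : ℝ≥0∞) : EReal)
          ≤ (τ₁ : EReal)) ∧
      τ₁ ≤ 2 * κ * (besselI (vmfOrder p + 1) κ / besselI (vmfOrder p) κ)) := by
  have hKL := fun x x' : UnitSphere p => tendsto_renyiDiv_vmfMechanism hp hκ x x'
  have hτ := tendsto_vmfTau hp hκ
  refine ⟨isProbabilityMeasure_vmfMechanism hp hκ, fun α hα => ?_,
    fun α hα x x' _ => renyiDiv_vmfMechanism_le_vmfTau hp hκ hα x x', hKL,
    _, hτ, fun x x' => ?_, le_rfl⟩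
  · simpa [vmfTau] using tendsto_vmfTauFormula_zero hp hα
  · refine le_of_tendsto_of_tendsto (hKL x x') ((continuous_coe_real_ereal.tendsto _).comp hτ) ?_
    filter_upwards [self_mem_nhdsWithin] with α hα
    exact renyiDiv_vmfMechanism_le_vmfTau hp hκ hα x x'
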